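/- Let $m,d\in\mathbb{N}=\{1,2,\ldots\}$ and $q\in\mathbb{N}_0$, let $(Z_t)_{t\in\mathbb{Z}}$ be an i.i.d. sequence of $\mathbb{C}^d$-valued random vectors on a probability space $(\Omega,\mathcal{F},\mathbb{P})$, and let $\Psi_1\in\mathbb{C}^{m\times m}$ and $\Theta_0,\ldots,\Theta_q\in\mathbb{C}^{m\times d}$. Let $\|\cdot\|$ be any fixed norm on $\mathbb{C}^d$, and put $\log^+ x:=\log\max\{1,x\}$. Assume that every eigenvalue of $\Psi_1$ has absolute value in $(0,1)\cup(1,\infty)$, that $d\le m$, and that the matrix $\sum_{k=0}^q\Psi_1^{q-k}\Theta_k$ has full rank $d$. Then there exists a strictly stationary $\mathbb{C}^m$-valued process $(Y_t)_{t\in\mathbb{Z}}$ on the same probability space $(\Omega,\mathcal{F},\mathbb{P})$ (that is, one whose finite-dimensional distributions are invariant under time shifts) which almost surely satisfies $$Y_t-\Psi_1Y_{t-1}=\sum_{k=0}^q\Theta_kZ_{t-k},\qquad t\in\mathbb{Z},$$ if and only if $\mathbb{E}\log^+\|Z_0\|<\infty$. -/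

import Mathlib

open MeasureTheory ProbabilityTheory

/-- A process `X` indexed by `ℤ` is strictly stationary under `P` if its finite-dimensional
distributions are invariant under time shifts: for all times `s 0, …, s (n - 1)` and every shift
`h`, the random elements `(X_{s i + h})_i` and `(X_{s i})_i` have the same law. -/
def IsStrictlyStationary {Ω E : Type*} [MeasurableSpace Ω] [MeasurableSpace E]
    (P : Measure Ω) (X : ℤ → Ω → E) : Prop :=
  ∀ (n : ℕ) (s : Fin n → ℤ) (h : ℤ),
    IdentDistrib (fun ω (i : Fin n) => X (s i + h) ω) (fun ω (i : Fin n) => X (s i) ω) P P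

/-- `Z` is an i.i.d. sequence, indexed by `ℤ`, of random elements of `E`. -/
structure IsIIDSequence {Ω E : Type*} [MeasurableSpace Ω] [MeasurableSpace E]
    (P : Measure Ω) (Z : ℤ → Ω → E) : Prop where
  measurable : ∀ t, Measurable (Z t)
  indep : iIndepFun Z P
  identDistrib : ∀ t, IdentDistrib (Z t) (Z 0) P P

/-- `Y` is a `ℂ^m`-valued process, on the probability space that carries `Z`, which almost surely
satisfies the ARMA(1,q) equation
`Y_t - Ψ Y_{t-1} = Θ_0 Z_t + ⋯ + Θ_q Z_{t-q}` for all `t ∈ ℤ`. -/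
structure IsARMASolution {Ω : Type*} [MeasurableSpace Ω] (P : Measure Ω) {m d q : ℕ}
    (Ψ : Matrix (Fin m) (Fin m) ℂ) (Θ : Fin (q + 1) → Matrix (Fin m) (Fin d) ℂ)
    (Z : ℤ → Ω → Fin d → ℂ) (Y : ℤ → Ω → Fin m → ℂ) : Prop where
  measurable : ∀ t, Measurable (Y t)
  equation : ∀ᵐ ω ∂P, ∀ t : ℤ,
    Y t ω - Ψ.mulVec (Y (t - 1) ω) =
      ∑ k : Fin (q + 1), (Θ k).mulVec (Z (t - ((k : ℕ) : ℤ)) ω)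

/-! Factor the characteristic polynomial of `Ψ` into its roots inside and outside the unit circle. A
Bézout identity for the two coprime factors, evaluated at `Ψ`, gives `p₁ + p₂ = 1` with `Ψ ^ k * p₁`
and `Ψ⁻¹ ^ k * p₂` decaying geometrically (`Matrix.exists_dichotomy`).

Necessity: subtracting a finite moving average from `Y` leaves `V` with `V_t - Ψ V_{t-1} = M
Z_{t-q}`, where `M` is the full-rank matrix, and `V` is bounded in probability. Iterating into the
past and applying `p₁`, the partial sums of the independent vectors `Ψ ^ j p₁ M Z_{-j-q}` stay
bounded in probability. By Ottaviani's inequality and the second Borel–Cantelli lemma their tails at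
some fixed level are summable. Since `Ψ ^ j` shrinks vectors at most geometrically, this makes
`P(‖p₁ M Z_0‖ > K c ^ j)` summable, which is a logarithmic moment. The inverse recursion does the
same for `p₂`; injectivity of `M` recombines both (`lintegral_posLog_lt_top_of_stationary`).

Sufficiency: the logarithmic moment makes geometrically weighted noise summable almost surely, so
convolution with the Green kernel of the recursion converges and is a solution; it is stationary as
a fixed functional of the shifted noise (`exists_stationary_solution`). -/

/-! ### Exponential dichotomy of a hyperbolic matrix. -/

section Dichotomy

/-- A sequence obeying a contractive affine recurrence with geometrically decaying forcing decays
geometrically. -/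
lemma exists_geometric_bound_of_recurrence {a : ℕ → ℝ} {ρ r K : ℝ} (hr : 0 < r)
    (hρ : 0 ≤ ρ) (hρr : ρ < r)
    (h : ∀ n, a (n + 1) ≤ ρ * a n + K * r ^ n) : ∃ C, ∀ n, a n ≤ C * r ^ n := by
  -- The second entry is the least `C` with `ρ * C + K ≤ C * r`, so the bound propagates.
  refine ⟨max (a 0) (K / (r - ρ)), fun n => ?_⟩
  have hK : K ≤ max (a 0) (K / (r - ρ)) * (r - ρ) := by
    rw [← div_le_iff₀ (sub_pos.2 hρr)]
    exact le_max_right _ _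
  induction n with
  | zero => simp
  | succ n ih =>
    have h1 := mul_le_mul_of_nonneg_left ih hρ
    have h2 := mul_le_mul_of_nonneg_right hK (pow_nonneg hr.le n)
    have h3 := h n
    rw [pow_succ]
    nlinarith

variable {A : Type*} [NormedRing A] [NormedAlgebra ℂ A]

-- Peel off one root: `y = (a - μ) x` is killed by the remaining factors, and `a ^ (n+1) x = μ a ^ n
-- x + a ^ n y` is a contractive recurrence forced by the decay of `y`. The strict inequality `‖μ‖ <
-- r` absorbs the polynomial growth caused by multiple roots.
open Polynomial in
lemma exists_norm_pow_mul_le {a : A} {r : ℝ} (hr : 0 < r) (s : Multiset ℂ)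
    (hs : ∀ μ ∈ s, ‖μ‖ < r) :
    ∀ x : A, aeval a (s.map fun μ => X - C μ).prod * x = 0 → ∃ K, ∀ n : ℕ, ‖a ^ n * x‖ ≤ K * r ^ n := by
  induction s using Multiset.induction with
  | empty =>
    intro x hx
    refine ⟨0, fun n => ?_⟩
    have : x = 0 := by simpa using hx
    simp [this]
  | cons μ s ih =>
    intro x hx
    obtain ⟨K, hK⟩ := ih (fun ν hν => hs ν (Multiset.mem_cons_of_mem hν))
      ((a - algebraMap ℂ A μ) * x) (by
        rw [← hx, Multiset.map_cons, Multiset.prod_cons, mul_comm, map_mul, ← mul_assoc]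
        simp)
    refine exists_geometric_bound_of_recurrence hr (norm_nonneg μ)
      (hs μ (Multiset.mem_cons_self μ s)) (K := K) fun n => ?_
    have e : a ^ (n + 1) * x = μ • (a ^ n * x) + a ^ n * ((a - algebraMap ℂ A μ) * x) := by
      rw [pow_succ, sub_mul, mul_sub, ← Algebra.smul_def, mul_smul_comm, mul_assoc]
      abel
    rw [e]
    refine (norm_add_le _ _).trans ?_
    rw [norm_smul]
    exact add_le_add le_rfl (hK n)

open Polynomial in
lemma exists_norm_inv_pow_mul_le (a : Aˣ) {r : ℝ} (hr : 0 < r) (s : Multiset ℂ)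
    (hs : ∀ μ ∈ s, μ ≠ 0 ∧ ‖μ⁻¹‖ < r) :
    ∀ x : A, aeval (a : A) (s.map fun μ => X - C μ).prod * x = 0 →
      ∃ K, ∀ n : ℕ, ‖((a⁻¹ : Aˣ) : A) ^ n * x‖ ≤ K * r ^ n := by
  induction s using Multiset.induction with
  | empty =>
    intro x hx
    refine ⟨0, fun n => ?_⟩
    have : x = 0 := by simpa using hx
    simp [this]
  | cons μ s ih =>
    intro x hx
    obtain ⟨K, hK⟩ := ih (fun ν hν => hs ν (Multiset.mem_cons_of_mem hν))
      (((a : A) - algebraMap ℂ A μ) * x) (by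
        rw [← hx, Multiset.map_cons, Multiset.prod_cons, mul_comm, map_mul, ← mul_assoc]
        simp)
    obtain ⟨hμ, hμr⟩ := hs μ (Multiset.mem_cons_self μ s)
    refine exists_geometric_bound_of_recurrence hr (norm_nonneg μ⁻¹) hμr
      -- The forcing term involves the power `n + 1`, whence the extra factor `r`.
      (K := ‖μ⁻¹‖ * (K * r)) fun n => ?_
    have e : ((a⁻¹ : Aˣ) : A) ^ (n + 1) * x = μ⁻¹ • (((a⁻¹ : Aˣ) : A) ^ n * x) -
        μ⁻¹ • (((a⁻¹ : Aˣ) : A) ^ (n + 1) * (((a : A) - algebraMap ℂ A μ) * x)) := by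
      rw [sub_mul, mul_sub, ← Algebra.smul_def, mul_smul_comm, smul_sub, inv_smul_smul₀ hμ,
        ← mul_assoc, pow_succ, mul_assoc _ _ (a : A), Units.inv_mul, mul_one]
      abel
    rw [e]
    refine (norm_sub_le _ _).trans ?_
    rw [norm_smul, norm_smul]
    refine add_le_add le_rfl ?_
    have := mul_le_mul_of_nonneg_left (hK (n + 1)) (norm_nonneg μ⁻¹)
    refine this.trans (le_of_eq ?_)
    ring

open scoped Matrix.Norms.Operator

open Polynomial in
/-- A hyperbolic invertible matrix splits the identity into a forward-decaying and a
backward-decaying part, both commuting with the matrix. -/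
lemma Matrix.exists_dichotomy {n : Type*} [Fintype n] [DecidableEq n] (u : (Matrix n n ℂ)ˣ)
    (hu : ∀ μ ∈ (u : Matrix n n ℂ).charpoly.roots, ‖μ‖ ≠ 1) :
    ∃ p₁ p₂ : Matrix n n ℂ, Commute (u : Matrix n n ℂ) p₁ ∧ Commute (u : Matrix n n ℂ) p₂ ∧
      p₁ + p₂ = 1 ∧ ∃ r K : ℝ, 0 < r ∧ r < 1 ∧
        (∀ k : ℕ, ‖(u : Matrix n n ℂ) ^ k * p₁‖ ≤ K * r ^ k) ∧
        ∀ k : ℕ, ‖((u⁻¹ : (Matrix n n ℂ)ˣ) : Matrix n n ℂ) ^ k * p₂‖ ≤ K * r ^ k := by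
  classical
  set χ := (u : Matrix n n ℂ).charpoly with hχ
  set s := χ.roots.filter fun μ => ‖μ‖ < 1
  set t := χ.roots.filter fun μ => ¬ ‖μ‖ < 1
  have hst : s + t = χ.roots := Multiset.filter_add_not _ _
  have hfac : (s.map fun μ => X - C μ).prod * (t.map fun μ => X - C μ).prod = χ := by
    rw [← Multiset.prod_add, ← Multiset.map_add, hst]
    exact ((IsAlgClosed.splits χ).eq_prod_roots_of_monic (Matrix.charpoly_monic _)).symm
  have hcop : IsCoprime (s.map fun μ => X - C μ).prod (t.map fun μ => X - C μ).prod := by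
    rw [isCoprime_iff_aeval_ne_zero_of_isAlgClosed ℂ ℂ]
    intro z
    by_contra! hz
    obtain ⟨h1, h2⟩ := hz
    simp only [coe_aeval_eq_eval, eval_multiset_prod, Multiset.map_map, Multiset.prod_eq_zero_iff,
      Multiset.mem_map, Function.comp_apply, eval_sub, eval_X, eval_C, sub_eq_zero] at h1 h2
    obtain ⟨μ, hμ, rfl⟩ := h1
    obtain ⟨ν, hν, h⟩ := h2
    rw [← h] at hν
    exact (Multiset.mem_filter.1 hν).2 (Multiset.mem_filter.1 hμ).2
  obtain ⟨f, g, hfg⟩ := hcop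
  have hχ0 : aeval (u : Matrix n n ℂ) χ = 0 := Matrix.aeval_self_charpoly _
  -- A single rate below one, strictly above the finitely many moduli, serves both halves.
  have hr : ∀ w : Multiset ℝ, (∀ x ∈ w, x < 1) → ∃ r : ℝ, 0 < r ∧ r < 1 ∧ ∀ x ∈ w, x < r := by
    intro w
    induction w using Multiset.induction with
    | empty => exact fun _ => ⟨1 / 2, by norm_num, by norm_num, by simp⟩
    | cons y w ih =>
      intro hw
      obtain ⟨r, h0, h1, h⟩ := ih fun x hx => hw x (Multiset.mem_cons_of_mem hx)
      obtain ⟨r', h2, h3⟩ := exists_between (max_lt h1 (hw y (Multiset.mem_cons_self y w)))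
      refine ⟨r', h0.trans ((le_max_left _ _).trans_lt h2), h3, fun x hx => ?_⟩
      rcases Multiset.mem_cons.1 hx with rfl | hx
      · exact (le_max_right _ _).trans_lt h2
      · exact (h x hx).trans ((le_max_left _ _).trans_lt h2)
  have ht : ∀ μ ∈ t, μ ≠ 0 ∧ ‖μ⁻¹‖ < 1 := by
    intro μ hμ
    obtain ⟨h1, h2⟩ := Multiset.mem_filter.1 hμ
    have h3 : 1 < ‖μ‖ := lt_of_le_of_ne (not_lt.1 h2) (hu μ h1).symm
    refine ⟨norm_pos_iff.1 (by linarith), ?_⟩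
    rw [norm_inv]
    exact inv_lt_one_of_one_lt₀ h3
  obtain ⟨r, hr0, hr1, hrw⟩ := hr (s.map (fun μ => ‖μ‖) + t.map fun μ => ‖μ⁻¹‖) (by
    intro x hx
    rcases Multiset.mem_add.1 hx with hx | hx
    · obtain ⟨μ, hμ, rfl⟩ := Multiset.mem_map.1 hx
      exact (Multiset.mem_filter.1 hμ).2
    · obtain ⟨μ, hμ, rfl⟩ := Multiset.mem_map.1 hx
      exact (ht μ hμ).2)
  have comm : ∀ f : ℂ[X], Commute (u : Matrix n n ℂ) (aeval (u : Matrix n n ℂ) f) := fun f => by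
    have := Commute.map (Commute.all (X : ℂ[X]) f) (aeval (u : Matrix n n ℂ))
    simpa using this
  -- The Bézout terms serve as `p₁` and `p₂`: multiplying each by the complementary factor yields a
  -- multiple of `χ`, which vanishes by Cayley–Hamilton.
  obtain ⟨K₁, h1⟩ := exists_norm_pow_mul_le (a := (u : Matrix n n ℂ)) hr0 s
    (fun μ hμ => hrw _ (Multiset.mem_add.2 (Or.inl (Multiset.mem_map_of_mem _ hμ))))
    (aeval (u : Matrix n n ℂ) (g * (t.map fun μ => X - C μ).prod)) (by
      rw [← map_mul, mul_left_comm, hfac, map_mul, hχ0, mul_zero])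
  obtain ⟨K₂, h2⟩ := exists_norm_inv_pow_mul_le u hr0 t
    (fun μ hμ => ⟨(ht μ hμ).1, hrw _ (Multiset.mem_add.2 (Or.inr (Multiset.mem_map_of_mem _ hμ)))⟩)
    (aeval (u : Matrix n n ℂ) (f * (s.map fun μ => X - C μ).prod)) (by
      rw [← map_mul, mul_left_comm, mul_comm _ (s.map _).prod, hfac, map_mul, hχ0, mul_zero])
  refine ⟨_, _, comm _, comm _, ?_, r, max K₁ K₂, hr0, hr1, fun k => (h1 k).trans ?_,
    fun k => (h2 k).trans ?_⟩
  · rw [← map_add, add_comm, hfg, map_one]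
  · exact mul_le_mul_of_nonneg_right (le_max_left _ _) (by positivity)
  · exact mul_le_mul_of_nonneg_right (le_max_right _ _) (by positivity)

/-- A matrix all of whose eigenvalues have modulus in `(0,1) ∪ (1,∞)` is invertible, and the roots
of its characteristic polynomial avoid the unit circle. -/
lemma Matrix.exists_unit_of_hyperbolic {n : Type*} [Fintype n] [DecidableEq n] (Ψ : Matrix n n ℂ)
    (hΨ : ∀ μ : ℂ, Module.End.HasEigenvalue (Matrix.toLin' Ψ) μ →
      ‖μ‖ ∈ Set.Ioo (0 : ℝ) 1 ∪ Set.Ioi (1 : ℝ)) :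
    ∃ u : (Matrix n n ℂ)ˣ, (u : Matrix n n ℂ) = Ψ ∧
      ∀ μ ∈ (u : Matrix n n ℂ).charpoly.roots, ‖μ‖ ≠ 1 := by
  have hsp : ∀ μ ∈ spectrum ℂ Ψ, ‖μ‖ ∈ Set.Ioo (0 : ℝ) 1 ∪ Set.Ioi (1 : ℝ) := fun μ hμ =>
    hΨ μ (Module.End.hasEigenvalue_iff_mem_spectrum.2 (by rwa [Matrix.spectrum_toLin']))
  have h0 : IsUnit Ψ := by
    by_contra h
    have := hsp 0 (spectrum.zero_mem_iff ℂ |>.2 h)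
    simp at this
    linarith
  obtain ⟨u, rfl⟩ := h0
  refine ⟨u, rfl, fun μ hμ h1 => ?_⟩
  have := hsp μ (Matrix.mem_spectrum_of_isRoot_charpoly (Polynomial.isRoot_of_mem_roots hμ))
  simp [h1] at this

end Dichotomy

/-! ### Boundedness in probability and sums of independent vectors. -/

section BoundedInProbability

open Filter
open scoped ENNReal Topology

variable {Ω ι E : Type*} [MeasurableSpace Ω] {P : Measure Ω} [NormedAddCommGroup E]

/-- A family of random elements is bounded in probability if its tails vanish uniformly. -/
def IsBoundedInProbability (P : Measure Ω) (V : ι → Ω → E) : Prop :=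
  ∀ ε : ℝ≥0∞, 0 < ε → ∃ K : ℝ, ∀ t, P {ω | K < ‖V t ω‖} ≤ ε

lemma exists_measure_lt_norm_le [IsFiniteMeasure P] [MeasurableSpace E] [OpensMeasurableSpace E]
    {X : Ω → E} (hX : Measurable X) {ε : ℝ≥0∞} (hε : 0 < ε) :
    ∃ K : ℝ, P {ω | K < ‖X ω‖} ≤ ε := by
  have h : Tendsto (fun n : ℕ => P {ω | (n : ℝ) < ‖X ω‖}) atTop
      (𝓝 (P (⋂ n : ℕ, {ω | (n : ℝ) < ‖X ω‖}))) := by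
    refine tendsto_measure_iInter_atTop (fun n => ?_) (fun a b hab ω hω => ?_)
      ⟨0, measure_ne_top _ _⟩
    · exact (measurableSet_lt measurable_const hX.norm).nullMeasurableSet
    · simp only [Set.mem_ofPred_eq] at hω ⊢
      exact lt_of_le_of_lt (by exact_mod_cast hab) hω
  have h0 : (⋂ n : ℕ, {ω | (n : ℝ) < ‖X ω‖}) = ∅ := by
    ext ω
    obtain ⟨n, hn⟩ := exists_nat_ge ‖X ω‖
    simp only [Set.mem_iInter, Set.mem_ofPred_eq, Set.mem_empty_iff_false, iff_false, not_forall]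
    exact ⟨n, not_lt.2 hn⟩
  rw [h0, measure_empty] at h
  obtain ⟨n, hn⟩ := (h.eventually (gt_mem_nhds hε)).exists
  exact ⟨n, hn.le⟩

namespace IsBoundedInProbability

lemma of_identDistrib [IsFiniteMeasure P] [MeasurableSpace E] [OpensMeasurableSpace E]
    {V : ι → Ω → E} {X : Ω → E} (hX : Measurable X) (h : ∀ t, IdentDistrib (V t) X P P) :
    IsBoundedInProbability P V := by
  intro ε hε
  obtain ⟨K, hK⟩ := exists_measure_lt_norm_le (P := P) hX hε
  refine ⟨K, fun t => ?_⟩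
  have := (h t).measure_mem_eq (s := {x | K < ‖x‖})
    (isOpen_lt continuous_const continuous_norm).measurableSet
  exact (le_of_eq this).trans hK

lemma mono_norm {F : Type*} [NormedAddCommGroup F] {V : ι → Ω → E} {W : ι → Ω → F}
    (h : IsBoundedInProbability P V) {C : ℝ} (hC : ∀ t, ∀ᵐ ω ∂P, ‖W t ω‖ ≤ C * ‖V t ω‖) :
    IsBoundedInProbability P W := by
  intro ε hε
  obtain ⟨K, hK⟩ := h ε hε
  refine ⟨max C 0 * K, fun t => (measure_mono_ae ?_).trans (hK t)⟩
  filter_upwards [hC t] with ω hω hlt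
  change max C 0 * K < ‖W t ω‖ at hlt
  change K < ‖V t ω‖
  by_contra! hle
  have h1 : ‖W t ω‖ ≤ max C 0 * ‖V t ω‖ :=
    hω.trans (mul_le_mul_of_nonneg_right (le_max_left _ _) (norm_nonneg _))
  have h2 := mul_le_mul_of_nonneg_left hle (le_max_right C 0)
  linarith

lemma comp {κ : Type*} {V : ι → Ω → E} (h : IsBoundedInProbability P V) (f : κ → ι) :
    IsBoundedInProbability P (fun k => V (f k)) := fun ε hε =>
  (h ε hε).imp fun _ hK k => hK (f k)

lemma add {V W : ι → Ω → E} (hV : IsBoundedInProbability P V) (hW : IsBoundedInProbability P W) :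
    IsBoundedInProbability P (fun t ω => V t ω + W t ω) := by
  intro ε hε
  obtain ⟨K, hK⟩ := hV (ε / 2) (ENNReal.half_pos hε.ne')
  obtain ⟨L, hL⟩ := hW (ε / 2) (ENNReal.half_pos hε.ne')
  refine ⟨K + L, fun t => ?_⟩
  have hsub : {ω | K + L < ‖V t ω + W t ω‖} ⊆ {ω | K < ‖V t ω‖} ∪ {ω | L < ‖W t ω‖} := by
    intro ω hω
    by_contra hcon
    simp only [Set.mem_union, Set.mem_ofPred_eq, not_or, not_lt] at hω hcon
    have := norm_add_le (V t ω) (W t ω)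
    linarith [hcon.1, hcon.2]
  calc _ ≤ _ := measure_mono hsub
    _ ≤ _ := measure_union_le _ _
    _ ≤ ε / 2 + ε / 2 := add_le_add (hK t) (hL t)
    _ = ε := ENNReal.add_halves ε

lemma sub {V W : ι → Ω → E} (hV : IsBoundedInProbability P V) (hW : IsBoundedInProbability P W) :
    IsBoundedInProbability P (fun t ω => V t ω - W t ω) := by
  have hW' : IsBoundedInProbability P (fun t ω => -W t ω) :=
    hW.mono_norm (C := 1) fun t => ae_of_all _ fun ω => by simp
  simpa only [sub_eq_add_neg] using hV.add hW'

lemma finset_sum {κ : Type*} (s : Finset κ) {V : κ → ι → Ω → E}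
    (h : ∀ k ∈ s, IsBoundedInProbability P (V k)) :
    IsBoundedInProbability P (fun t ω => ∑ k ∈ s, V k t ω) := by
  classical
  induction s using Finset.induction with
  | empty => exact fun ε _ => ⟨0, fun t => by simp⟩
  | insert k s hk ih =>
    simp only [Finset.sum_insert hk]
    exact (h k (Finset.mem_insert_self _ _)).add
      (ih fun j hj => h j (Finset.mem_insert_of_mem hj))

end IsBoundedInProbability

variable [MeasurableSpace E] [BorelSpace E] [SecondCountableTopology E]

lemma measurable_norm_finset_sum {α κ : Type*} {m : MeasurableSpace α} {X : κ → α → E}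
    (s : Finset κ) (h : ∀ i ∈ s, Measurable (X i)) : Measurable fun ω => ‖∑ i ∈ s, X i ω‖ :=
  (Finset.measurable_fun_sum s h).norm

/-- **Ottaviani's inequality**. -/
lemma measure_exists_lt_norm_sum_le [IsProbabilityMeasure P] {X : ℕ → Ω → E}
    (hX : ∀ k, Measurable (X k)) (hind : iIndepFun X P) {K : ℝ} (n : ℕ)
    (hK : ∀ k ≤ n, P {ω | K < ‖∑ i ∈ Finset.Ico k n, X i ω‖} ≤ 1 / 2) :
    P {ω | ∃ k ≤ n, 2 * K < ‖∑ i ∈ Finset.range k, X i ω‖} ≤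
      2 * P {ω | K < ‖∑ i ∈ Finset.range n, X i ω‖} := by
  set m : ℕ → MeasurableSpace Ω := fun i => MeasurableSpace.comap (X i) inferInstance
  have hle : ∀ i, m i ≤ (inferInstance : MeasurableSpace Ω) := fun i => (hX i).comap_le
  have hiI : iIndep m P := hind
  -- `A k` says that the partial sums first exceed `2K` at time `k`, and depends on the indices
  -- below `k`; `B k` says that the remaining sum is at most `K`, and depends on the others.
  -- Together they force the full sum above `K`.
  set A : ℕ → Set Ω := fun k => {ω | 2 * K < ‖∑ i ∈ Finset.range k, X i ω‖} ∩
    ⋂ j ∈ Finset.range k, {ω | ‖∑ i ∈ Finset.range j, X i ω‖ ≤ 2 * K} with hA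
  set B : ℕ → Set Ω := fun k => {ω | ‖∑ i ∈ Finset.Ico k n, X i ω‖ ≤ K} with hB
  have hsum : ∀ (T : Set ℕ) (s : Finset ℕ), (↑s ⊆ T) →
      Measurable[⨆ i ∈ T, m i] fun ω => ‖∑ i ∈ s, X i ω‖ := by
    intro T s hs
    refine measurable_norm_finset_sum s fun i hi => ?_
    exact (comap_measurable (X i)).mono (le_iSup₂_of_le i (hs hi) le_rfl) le_rfl
  have hAm : ∀ k, MeasurableSet[⨆ i ∈ Set.Iio k, m i] (A k) := by
    intro k
    refine MeasurableSet.inter ?_ (Finset.measurableSet_biInter _ fun j hj => ?_)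
    · exact measurableSet_lt measurable_const (hsum _ _ (by simp))
    · refine measurableSet_le (hsum _ _ ?_) measurable_const
      intro i hi
      have h1 := Finset.mem_range.1 hj
      have h2 := Finset.mem_range.1 (Finset.mem_coe.1 hi)
      exact h2.trans h1
  have hBm : ∀ k, MeasurableSet[⨆ i ∈ Set.Ici k, m i] (B k) := by
    intro k
    refine measurableSet_le (hsum _ _ ?_) measurable_const
    intro i hi
    exact (Finset.mem_Ico.1 (Finset.mem_coe.1 hi)).1
  have hindep : ∀ k, P (A k ∩ B k) = P (A k) * P (B k) := by
    intro k
    have hd : Disjoint (Set.Iio k) (Set.Ici k) :=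
      Set.disjoint_left.2 fun i hi hi' => not_le.2 (Set.mem_Iio.1 hi) (Set.mem_Ici.1 hi')
    exact (Indep_iff _ _ P).1 (indep_iSup_of_disjoint hle hiI hd) _ _ (hAm k) (hBm k)
  have hAm' : ∀ k, MeasurableSet (A k) := fun k => (iSup₂_le fun i _ => hle i) _ (hAm k)
  have hBm' : ∀ k, MeasurableSet (B k) := fun k => (iSup₂_le fun i _ => hle i) _ (hBm k)
  have hBge : ∀ k ≤ n, 1 ≤ 2 * P (B k) := by
    intro k hk
    have h1 : (B k)ᶜ = {ω | K < ‖∑ i ∈ Finset.Ico k n, X i ω‖} := by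
      ext ω; simp [hB]
    have h2 : P (B k) + P (B k)ᶜ = 1 := by rw [measure_add_measure_compl (hBm' k), measure_univ]
    have h3 : P (B k)ᶜ ≤ 1 / 2 := h1 ▸ hK k hk
    have h4 : (1 : ℝ≥0∞) / 2 ≤ P (B k) := by
      by_contra! hlt
      have := ENNReal.add_lt_add_of_lt_of_le (ne_top_of_le_ne_top (by simp) h3) hlt h3
      rw [h2, ENNReal.add_halves] at this
      exact lt_irrefl _ this
    calc (1 : ℝ≥0∞) = 2 * (1 / 2) := by rw [ENNReal.mul_div_cancel (by simp) (by simp)]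
      _ ≤ _ := by gcongr
  have hdisj : Set.Pairwise (↑(Finset.range (n + 1))) fun i j =>
      Disjoint (A i ∩ B i) (A j ∩ B j) := by
    have key : ∀ i j, i < j → Disjoint (A i ∩ B i) (A j ∩ B j) := by
      intro i j hij
      refine Set.disjoint_left.2 fun ω h1 h2 => ?_
      have h3 := Set.mem_iInter₂.1 h2.1.2 i (Finset.mem_range.2 hij)
      exact not_le.2 (show 2 * K < _ from h1.1.1) h3
    intro i _ j _ hij
    rcases lt_or_gt_of_ne hij with h | h
    · exact key i j h
    · exact (key j i h).symm
  calc P {ω | ∃ k ≤ n, 2 * K < ‖∑ i ∈ Finset.range k, X i ω‖}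
      ≤ P (⋃ k ∈ Finset.range (n + 1), A k) := by
        refine measure_mono fun ω hω => ?_
        classical
        have hω' : ∃ k, k ≤ n ∧ 2 * K < ‖∑ i ∈ Finset.range k, X i ω‖ := hω
        refine Set.mem_iUnion₂.2 ⟨Nat.find hω', ?_, (Nat.find_spec hω').2, ?_⟩
        · exact Finset.mem_range.2 (Nat.lt_succ_of_le (Nat.find_spec hω').1)
        · refine Set.mem_iInter₂.2 fun j hj => ?_
          have hj' := Finset.mem_range.1 hj
          have := Nat.find_min hω' hj'
          simp only [not_and, not_lt] at this
          exact this (hj'.le.trans (Nat.find_spec hω').1)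
    _ ≤ ∑ k ∈ Finset.range (n + 1), P (A k) := measure_biUnion_finset_le _ _
    _ ≤ ∑ k ∈ Finset.range (n + 1), 2 * P (A k ∩ B k) := by
        refine Finset.sum_le_sum fun k hk => ?_
        rw [hindep, mul_left_comm]
        exact le_mul_of_one_le_right' (hBge k (Nat.lt_succ_iff.1 (Finset.mem_range.1 hk)))
    _ = 2 * P (⋃ k ∈ Finset.range (n + 1), A k ∩ B k) := by
        rw [← Finset.mul_sum, measure_biUnion_finset hdisj
          fun k _ => (hAm' k).inter (hBm' k)]
    _ ≤ 2 * P {ω | K < ‖∑ i ∈ Finset.range n, X i ω‖} := by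
        gcongr
        refine Set.iUnion₂_subset fun k hk ω hω => ?_
        have hk' := Nat.lt_succ_iff.1 (Finset.mem_range.1 hk)
        have h1 : 2 * K < ‖∑ i ∈ Finset.range k, X i ω‖ := hω.1.1
        have h2 : ‖∑ i ∈ Finset.Ico k n, X i ω‖ ≤ K := hω.2
        change K < ‖∑ i ∈ Finset.range n, X i ω‖
        rw [← Finset.sum_range_add_sum_Ico _ hk']
        have := norm_le_norm_add_norm_sub' (∑ i ∈ Finset.range k, X i ω)
          (∑ i ∈ Finset.range k, X i ω + ∑ i ∈ Finset.Ico k n, X i ω)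
        rw [norm_sub_rev, add_sub_cancel_left] at this
        linarith

/-- If the partial sums of independent random elements are bounded in probability, then the tails
of the summands are summable at some level. -/
lemma exists_tsum_measure_lt_norm_ne_top [IsProbabilityMeasure P] {X : ℕ → Ω → E}
    (hX : ∀ k, Measurable (X k)) (hind : iIndepFun X P)
    (hb : IsBoundedInProbability P fun n ω => ∑ i ∈ Finset.range n, X i ω) :
    ∃ K : ℝ, ∑' k, P {ω | K < ‖X k ω‖} ≠ ∞ := by
  -- Differences of partial sums turn 1/8 into 1/4, and Ottaviani's factor 2 turns this into 1/2,
  -- still below one.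
  obtain ⟨K, hK⟩ := hb (1 / 8) (by simp)
  have hS : ∀ n, ∀ k ≤ n, P {ω | 2 * K < ‖∑ i ∈ Finset.Ico k n, X i ω‖} ≤ 1 / 4 := by
    intro n k hk
    calc _ ≤ P ({ω | K < ‖∑ i ∈ Finset.range k, X i ω‖} ∪
            {ω | K < ‖∑ i ∈ Finset.range n, X i ω‖}) := by
          refine measure_mono fun ω hω => ?_
          by_contra hcon
          simp only [Set.mem_union, Set.mem_ofPred_eq, not_or, not_lt] at hω hcon
          rw [Finset.sum_Ico_eq_sub _ hk] at hω
          have := norm_sub_le (∑ i ∈ Finset.range n, X i ω) (∑ i ∈ Finset.range k, X i ω)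
          linarith [hcon.1, hcon.2]
      _ ≤ 1 / 8 + 1 / 8 := (measure_union_le _ _).trans (add_le_add (hK k) (hK n))
      _ = 1 / 4 := by
          rw [← two_mul, show (4 : ℝ≥0∞) = 2 * 2 by norm_num, show (8 : ℝ≥0∞) = 2 * (2 * 2) by norm_num,
            one_div, one_div, ENNReal.mul_inv (by simp) (by simp), ← mul_assoc,
            ENNReal.mul_inv_cancel (by simp) (by simp), one_mul]
  have hquarter : (1 : ℝ≥0∞) / 4 ≤ 1 / 2 := by
    rw [one_div, one_div]
    exact ENNReal.inv_le_inv.2 (by norm_num)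
  have hmax : ∀ n, P {ω | ∃ k ≤ n, 2 * (2 * K) < ‖∑ i ∈ Finset.range k, X i ω‖} ≤ 1 / 2 := by
    intro n
    refine (measure_exists_lt_norm_sum_le hX hind n
      fun k hk => (hS n k hk).trans hquarter).trans ?_
    have := hS n 0 (Nat.zero_le n)
    rw [← Finset.range_eq_Ico] at this
    calc _ ≤ 2 * (1 / 4 : ℝ≥0∞) := by gcongr
      _ = 1 / 2 := by
          rw [show (4 : ℝ≥0∞) = 2 * 2 by norm_num, one_div, one_div,
            ENNReal.mul_inv (by simp) (by simp), ← mul_assoc,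
            ENNReal.mul_inv_cancel (by simp) (by simp), one_mul]
  have hall : P (⋃ n : ℕ, {ω | ∃ k ≤ n, 2 * (2 * K) < ‖∑ i ∈ Finset.range k, X i ω‖}) ≤ 1 / 2 := by
    rw [Monotone.measure_iUnion]
    · exact iSup_le hmax
    · intro a b hab ω hω
      obtain ⟨k, hk, h⟩ := hω
      exact ⟨k, hk.trans hab, h⟩
  -- A summand above `8K` forces one of two adjacent partial sums above `4K`. Divergence would make
  -- this almost sure by Borel–Cantelli, against the bound 1/2.
  refine ⟨2 * (2 * (2 * K)), fun htop => ?_⟩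
  have hset : ∀ _ : ℕ, MeasurableSet {x : E | 2 * (2 * (2 * K)) < ‖x‖} := fun _ =>
    (isOpen_lt continuous_const continuous_norm).measurableSet
  have hXset : ∀ k, MeasurableSet {ω | 2 * (2 * (2 * K)) < ‖X k ω‖} := fun k => hX k (hset k)
  have hiS : iIndepSet (fun k => {ω | 2 * (2 * (2 * K)) < ‖X k ω‖}) P := by
    rw [iIndepSet_iff_meas_biInter hXset]
    exact fun s => hind.measure_inter_preimage_eq_mul s fun k _ => hset k
  have h1 := measure_limsup_eq_one hXset hiS htop
  have h2 : limsup (fun k => {ω | 2 * (2 * (2 * K)) < ‖X k ω‖}) atTop ⊆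
      ⋃ n : ℕ, {ω | ∃ k ≤ n, 2 * (2 * K) < ‖∑ i ∈ Finset.range k, X i ω‖} := by
    intro ω hω
    rw [Filter.mem_limsup_iff_frequently_mem] at hω
    obtain ⟨k, hk⟩ := hω.exists
    change 2 * (2 * (2 * K)) < ‖X k ω‖ at hk
    refine Set.mem_iUnion.2 ⟨k + 1, ?_⟩
    by_contra hcon
    simp only [Set.mem_ofPred_eq, not_exists, not_and, not_lt] at hcon
    have h3 := hcon k (Nat.le_succ k)
    have h4 := hcon (k + 1) le_rfl
    have h5 : X k ω = ∑ i ∈ Finset.range (k + 1), X i ω - ∑ i ∈ Finset.range k, X i ω := by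
      rw [Finset.sum_range_succ, add_sub_cancel_left]
    have h6 := norm_sub_le (∑ i ∈ Finset.range (k + 1), X i ω) (∑ i ∈ Finset.range k, X i ω)
    rw [← h5] at h6
    linarith
  have h3 := (measure_mono h2).trans hall
  rw [h1, one_div] at h3
  have : (2 : ℝ≥0∞)⁻¹ < 1 := by norm_num
  exact absurd h3 (not_le.2 this)

end BoundedInProbability

/-! ### Logarithmic moments versus geometric tails. -/

section LogMoment

open Filter Real
open scoped ENNReal Topology

variable {Ω : Type*} [MeasurableSpace Ω] {P : Measure Ω}

/-- On the logarithmic scale, `log⁺ X` is at most `log L` plus `log c` times the number of levels `L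
* c ^ k` below `X`; the expected number is the given series, up to enlarging `K` to `L`. -/
lemma lintegral_posLog_lt_top_of_tsum [IsProbabilityMeasure P] {X : Ω → ℝ} (hX : Measurable X)
    (h0 : ∀ ω, 0 ≤ X ω) {c K : ℝ} (hc : 1 < c)
    (h : ∑' k : ℕ, P {ω | K * c ^ k < X ω} ≠ ∞) :
    ∫⁻ ω, ENNReal.ofReal (log⁺ (X ω)) ∂P < ∞ := by
  set L := max K 1
  have hL : 1 ≤ L := le_max_right _ _
  have hms : ∀ k : ℕ, MeasurableSet {ω | L * c ^ k < X ω} := fun k =>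
    measurableSet_lt measurable_const hX
  have hpt : ∀ ω, ENNReal.ofReal (log⁺ (X ω)) ≤ ENNReal.ofReal (log L) +
      ENNReal.ofReal (log c) * ∑' k : ℕ, {ω | L * c ^ k < X ω}.indicator 1 ω := by
    intro ω
    classical
    have hex : ∃ n : ℕ, X ω ≤ L * c ^ n := by
      obtain ⟨n, hn⟩ := pow_unbounded_of_one_lt (X ω) hc
      exact ⟨n, hn.le.trans (le_mul_of_one_le_left (by positivity) hL)⟩
    have h1 : ((Nat.find hex : ℕ) : ℝ≥0∞) ≤
        ∑' k : ℕ, {ω | L * c ^ k < X ω}.indicator (1 : Ω → ℝ≥0∞) ω := by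
      refine le_trans (le_of_eq ?_) (ENNReal.sum_le_tsum (Finset.range (Nat.find hex)))
      rw [Finset.sum_congr rfl (g := fun _ => (1 : ℝ≥0∞))]
      · simp
      · intro k hk
        have := Nat.find_min hex (Finset.mem_range.1 hk)
        exact Set.indicator_of_mem (s := {ω | L * c ^ k < X ω}) (not_le.1 this) 1
    have h2 : log⁺ (X ω) ≤ log L + log c * (Nat.find hex : ℕ) := by
      refine (posLog_le_posLog (h0 ω) (Nat.find_spec hex)).trans ?_
      have hc0 : 0 < c := by linarith
      rw [posLog_eq_log, log_mul (by positivity) (by positivity), log_pow, mul_comm (log c)]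
      rw [abs_of_nonneg (by positivity)]
      exact one_le_mul_of_one_le_of_one_le hL (one_le_pow₀ hc.le)
    calc _ ≤ ENNReal.ofReal (log L + log c * (Nat.find hex : ℕ)) := ENNReal.ofReal_le_ofReal h2
      _ = ENNReal.ofReal (log L) + ENNReal.ofReal (log c) * (Nat.find hex : ℕ) := by
          rw [ENNReal.ofReal_add (log_nonneg hL) (mul_nonneg (log_nonneg hc.le) (by positivity)),
            ENNReal.ofReal_mul (log_nonneg hc.le), ENNReal.ofReal_natCast]
      _ ≤ _ := by gcongr
  refine (lintegral_mono hpt).trans_lt ?_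
  rw [lintegral_add_left measurable_const, lintegral_const_mul _ (Measurable.tsum fun k =>
    (measurable_one.indicator (hms k))), lintegral_tsum fun k =>
    (measurable_one.indicator (hms k)).aemeasurable]
  · simp only [lintegral_indicator_one (hms _), lintegral_const, measure_univ, mul_one]
    refine ENNReal.add_lt_top.2 ⟨ENNReal.ofReal_lt_top,
      ENNReal.mul_lt_top ENNReal.ofReal_lt_top (lt_of_le_of_lt ?_ (lt_top_iff_ne_top.2 h))⟩
    refine ENNReal.tsum_le_tsum fun k => measure_mono fun ω hω => ?_
    have hcp : 0 ≤ c ^ k := pow_nonneg (by linarith) k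
    exact lt_of_le_of_lt (mul_le_mul_of_nonneg_right (le_max_left K 1) hcp) hω

/-- Write `r = ρ * ρ`. The finite logarithmic moment and the first Borel–Cantelli lemma give `X k ≤
ρ ^ (-k)` eventually; one factor `ρ ^ k` absorbs this and the other is summable. No independence is
required. -/
lemma ae_summable_pow_mul_of_lintegral_posLog [IsProbabilityMeasure P] {X : ℕ → Ω → ℝ} {X₀ : Ω → ℝ}
    (hX₀ : Measurable X₀) (h0 : ∀ k ω, 0 ≤ X k ω)
    (hid : ∀ k, IdentDistrib (X k) X₀ P P)
    (h : ∫⁻ ω, ENNReal.ofReal (log⁺ (X₀ ω)) ∂P < ∞) {r : ℝ} (hr0 : 0 < r) (hr1 : r < 1) :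
    ∀ᵐ ω ∂P, Summable fun k : ℕ => r ^ k * X k ω := by
  set ρ := √r
  have hρ0 : 0 < ρ := sqrt_pos.2 hr0
  have hρ1 : ρ < 1 := by rw [sqrt_lt' one_pos]; simpa using hr1
  have hρr : r = ρ * ρ := (mul_self_sqrt hr0.le).symm
  set δ := -log ρ
  have hδ : 0 < δ := neg_pos.2 (log_neg hρ0 hρ1)
  -- `tsum_prob_mem_Ioi_lt_top` is applied with `P` as `volume`.
  let : MeasureSpace Ω := ⟨P⟩
  have : IsProbabilityMeasure (volume : Measure Ω) := ‹IsProbabilityMeasure P›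
  have hmeas : Measurable fun ω => log⁺ (X₀ ω) := continuous_posLog.measurable.comp hX₀
  have hint : Integrable (fun ω => log⁺ (X₀ ω) / δ) (volume : Measure Ω) := by
    refine Integrable.div_const ⟨hmeas.aestronglyMeasurable, ?_⟩ δ
    rw [hasFiniteIntegral_iff_ofReal (ae_of_all _ fun ω => posLog_nonneg)]
    exact h
  have h1 := tsum_prob_mem_Ioi_lt_top hint (fun ω => div_nonneg posLog_nonneg hδ.le)
  have h2 : ∑' k : ℕ, P {ω | (k : ℝ) < log⁺ (X k ω) / δ} ≠ ∞ := by
    refine ne_of_lt (lt_of_le_of_lt (ENNReal.tsum_le_tsum fun k => le_of_eq ?_) h1)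
    exact (hid k).measure_mem_eq (s := {x | (k : ℝ) < log⁺ x / δ})
      (measurableSet_lt measurable_const (continuous_posLog.measurable.div_const δ))
  filter_upwards [ae_eventually_notMem h2] with ω hω
  refine Summable.of_norm_bounded_eventually_nat (summable_geometric_of_lt_one hρ0.le hρ1) ?_
  filter_upwards [hω] with k hk
  have hk' : log⁺ (X k ω) ≤ k * δ := by
    rw [← div_le_iff₀ hδ]
    exact not_lt.1 hk
  have hXk : X k ω ≤ (ρ ^ k)⁻¹ := by
    rcases (h0 k ω).eq_or_lt with h3 | h3
    · rw [← h3]; positivity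
    · rw [← log_le_log_iff h3 (by positivity), log_inv, log_pow]
      have h4 : log (X k ω) ≤ log⁺ (X k ω) := le_max_right _ _
      have h5 : (k : ℝ) * δ = -(k * log ρ) := by simp [δ]
      linarith
  rw [norm_of_nonneg (mul_nonneg (by positivity) (h0 k ω)), hρr, mul_pow, mul_assoc]
  calc ρ ^ k * (ρ ^ k * X k ω) ≤ ρ ^ k * (ρ ^ k * (ρ ^ k)⁻¹) := by gcongr
    _ = ρ ^ k := by rw [mul_inv_cancel₀ (by positivity), mul_one]

end LogMoment

/-! ### Equivalence of the given norm with the sup norm. -/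

section Seminorm

variable {d : ℕ} (p : Seminorm ℂ (Fin d → ℂ))

lemma Seminorm.exists_le_mul_norm : ∃ c : ℝ, 0 ≤ c ∧ ∀ x, p x ≤ c * ‖x‖ := by
  refine ⟨∑ i, p (Pi.single i 1), Finset.sum_nonneg fun i _ => apply_nonneg p _, fun x => ?_⟩
  have hx : x = ∑ i, x i • (Pi.single i 1 : Fin d → ℂ) := by
    ext j
    simp [Finset.sum_apply, Pi.single_apply]
  conv_lhs => rw [hx]
  refine (Finset.le_sum_of_subadditive p (map_zero p).le (fun a b => map_add_le_add p a b) _ _).trans ?_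
  rw [Finset.sum_mul]
  refine Finset.sum_le_sum fun i _ => ?_
  rw [map_smul_eq_mul, mul_comm]
  exact mul_le_mul_of_nonneg_left (norm_le_pi_norm x i) (apply_nonneg p _)

lemma Seminorm.exists_norm_le_mul (hp : ∀ x, p x = 0 → x = 0) :
    ∃ c : ℝ, 0 ≤ c ∧ ∀ x, ‖x‖ ≤ c * p x := by
  obtain ⟨C, hC0, hC⟩ := p.exists_le_mul_norm
  have hcont : Continuous p := by
    refine (LipschitzWith.of_dist_le' (K := C) fun x y => ?_).continuous
    rw [Real.dist_eq, dist_eq_norm]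
    exact (abs_sub_map_le_sub p x y).trans (hC _)
  -- The sphere is empty when `d = 0`; otherwise compactness gives a positive minimum of `p` on it.
  rcases (Metric.sphere (0 : Fin d → ℂ) 1).eq_empty_or_nonempty with he | hne
  · refine ⟨0, le_rfl, fun x => ?_⟩
    rcases eq_or_ne x 0 with rfl | hx
    · simp
    · have : ((‖x‖⁻¹ : ℝ) : ℂ) • x ∈ Metric.sphere (0 : Fin d → ℂ) 1 := by
        rw [mem_sphere_zero_iff_norm, norm_smul]
        simp [norm_ne_zero_iff.2 hx]
      rw [he] at this
      exact absurd this (Set.notMem_empty _)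
  · obtain ⟨y, hy, hmin⟩ := (isCompact_sphere (0 : Fin d → ℂ) 1).exists_isMinOn hne
      hcont.continuousOn
    have hy0 : 0 < p y := by
      refine lt_of_le_of_ne (apply_nonneg p y) fun h => ?_
      rw [hp y h.symm] at hy
      simp at hy
    refine ⟨(p y)⁻¹, inv_nonneg.2 hy0.le, fun x => ?_⟩
    rcases eq_or_ne x 0 with rfl | hx
    · simp
    · have hs : ((‖x‖⁻¹ : ℝ) : ℂ) • x ∈ Metric.sphere (0 : Fin d → ℂ) 1 := by
        rw [mem_sphere_zero_iff_norm, norm_smul]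
        simp [norm_ne_zero_iff.2 hx]
      have h1 : p y ≤ p (((‖x‖⁻¹ : ℝ) : ℂ) • x) := hmin hs
      rw [map_smul_eq_mul, Complex.norm_real, norm_inv, norm_norm] at h1
      have hx0 := norm_pos_iff.2 hx
      rw [inv_mul_eq_div, le_div_iff₀ hx0] at h1
      rw [inv_mul_eq_div, le_div_iff₀ hy0]
      linarith

end Seminorm

/-! ### Necessity of the logarithmic moment. -/

section Necessity

open Real
open scoped Matrix Matrix.Norms.Operator ENNReal

variable {Ω : Type*} [MeasurableSpace Ω] {P : Measure Ω} {m d q : ℕ}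

lemma measurable_mulVec {k l : ℕ} (A : Matrix (Fin k) (Fin l) ℂ) :
    Measurable fun x : Fin l → ℂ => A *ᵥ x :=
  (Continuous.matrix_mulVec continuous_const continuous_id).measurable

lemma IsStrictlyStationary.identDistrib {E : Type*} [MeasurableSpace E] {Y : ℤ → Ω → E}
    (h : IsStrictlyStationary P Y) (t : ℤ) : IdentDistrib (Y t) (Y 0) P P := by
  simpa [Function.comp_def] using
    (h 1 (fun _ => 0) t).comp (measurable_pi_apply (0 : Fin 1))

/-- If a process solving a first-order recursion is bounded in probability, then the part of the
driving noise on which the recursion does not expand has a finite logarithmic moment. -/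
lemma lintegral_posLog_lt_top_of_recursion [IsProbabilityMeasure P] {Z : ℤ → Ω → Fin d → ℂ}
    (hZ : IsIIDSequence P Z) {f : ℕ → ℤ} (hf : Function.Injective f)
    (u : (Matrix (Fin m) (Fin m) ℂ)ˣ) {Q : Matrix (Fin m) (Fin m) ℂ}
    (hQ : Commute (u : Matrix (Fin m) (Fin m) ℂ) Q) {C : ℝ}
    (hC : ∀ n : ℕ, ‖(u : Matrix (Fin m) (Fin m) ℂ) ^ n * Q‖ ≤ C)
    (B : Matrix (Fin m) (Fin d) ℂ) {V : ℕ → Ω → Fin m → ℂ} (hV : IsBoundedInProbability P V)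
    (hrec : ∀ᵐ ω ∂P, ∀ j, V j ω - (u : Matrix (Fin m) (Fin m) ℂ) *ᵥ V (j + 1) ω = B *ᵥ Z (f j) ω) :
    ∫⁻ ω, ENNReal.ofReal (log⁺ ‖Q *ᵥ (B *ᵥ Z 0 ω)‖) ∂P < ∞ := by
  set U : Matrix (Fin m) (Fin m) ℂ := (u : Matrix (Fin m) (Fin m) ℂ)
  set W : Matrix (Fin m) (Fin m) ℂ := ((u⁻¹ : (Matrix (Fin m) (Fin m) ℂ)ˣ) : Matrix (Fin m) (Fin m) ℂ)
  have hWU : ∀ j : ℕ, W ^ j * U ^ j = 1 := fun j => by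
    rw [← Units.val_pow_eq_pow_val, ← Units.val_pow_eq_pow_val, inv_pow, Units.inv_mul]
  set X : ℕ → Ω → Fin m → ℂ := fun j ω => (U ^ j * Q) *ᵥ (B *ᵥ Z (f j) ω)
  have hg : ∀ j : ℕ, Measurable fun z : Fin d → ℂ => (U ^ j * Q) *ᵥ (B *ᵥ z) := fun j =>
    (measurable_mulVec _).comp (measurable_mulVec _)
  have hXm : ∀ j, Measurable (X j) := fun j => (hg j).comp (hZ.measurable _)
  have hXi : iIndepFun X P := (hZ.indep.precomp hf).comp _ hg
  -- Since `Q` commutes with `U`, applying `U ^ j * Q` to the recursion makes it telescope.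
  have hsum : ∀ᵐ ω ∂P, ∀ n, ∑ j ∈ Finset.range n, X j ω = Q *ᵥ V 0 ω - (U ^ n * Q) *ᵥ V n ω := by
    filter_upwards [hrec] with ω hω n
    have hX : ∀ j, X j ω = (U ^ j * Q) *ᵥ V j ω - (U ^ (j + 1) * Q) *ᵥ V (j + 1) ω := fun j => by
      simp only [X]
      rw [← hω j, Matrix.mulVec_sub, Matrix.mulVec_mulVec, pow_succ, mul_assoc, mul_assoc,
        hQ.eq]
    rw [Finset.sum_congr rfl fun j _ => hX j,
      Finset.sum_range_sub' fun j => (U ^ j * Q) *ᵥ V j ω]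
    simp
  have hb : IsBoundedInProbability P fun n ω => ∑ j ∈ Finset.range n, X j ω := by
    have h1 : IsBoundedInProbability P fun (_ : ℕ) ω => Q *ᵥ V 0 ω :=
      (hV.comp fun _ : ℕ => 0).mono_norm (C := ‖Q‖) fun t => ae_of_all _ fun ω =>
        Matrix.linfty_opNorm_mulVec _ _
    have h2 : IsBoundedInProbability P fun n ω => (U ^ n * Q) *ᵥ V n ω :=
      hV.mono_norm (C := C) fun t => ae_of_all _ fun ω =>
        (Matrix.linfty_opNorm_mulVec _ _).trans
          (mul_le_mul_of_nonneg_right (hC t) (norm_nonneg _))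
    refine (h1.sub h2).mono_norm (C := 1) fun n => ?_
    filter_upwards [hsum] with ω hω
    rw [hω n, one_mul]
  obtain ⟨K, hK⟩ := exists_tsum_measure_lt_norm_ne_top hXm hXi hb
  have hQB : Measurable fun z : Fin d → ℂ => ‖Q *ᵥ (B *ᵥ z)‖ :=
    ((measurable_mulVec Q).comp (measurable_mulVec B)).norm
  -- The projected noise is recovered as `W ^ j` applied to `X j`, so it is at most `c ^ j` times
  -- larger; the 2 guarantees `c > 1`.
  set c := max ‖W‖ 2
  have hc0 : 0 < c := lt_of_lt_of_le two_pos (le_max_right _ _)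
  refine lintegral_posLog_lt_top_of_tsum (c := c) (K := K) (hQB.comp (hZ.measurable 0))
    (fun ω => norm_nonneg _) (lt_of_lt_of_le one_lt_two (le_max_right _ _))
    (ne_top_of_le_ne_top hK (ENNReal.tsum_le_tsum fun j => ?_))
  have h1 := (hZ.identDistrib (f j)).measure_mem_eq (s := {z | K * c ^ j < ‖Q *ᵥ (B *ᵥ z)‖})
    (measurableSet_lt measurable_const hQB)
  refine (le_of_eq h1.symm).trans (measure_mono fun ω hω => ?_)
  change K * c ^ j < ‖Q *ᵥ (B *ᵥ Z (f j) ω)‖ at hω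
  change K < ‖X j ω‖
  have h2 : Q *ᵥ (B *ᵥ Z (f j) ω) = W ^ j *ᵥ X j ω := by
    simp only [X]
    rw [Matrix.mulVec_mulVec _ (W ^ j), ← mul_assoc, hWU, one_mul]
  have h3 : ‖W ^ j *ᵥ X j ω‖ ≤ c ^ j * ‖X j ω‖ := by
    rcases j.eq_zero_or_pos with rfl | hj
    · simp
    · refine (Matrix.linfty_opNorm_mulVec _ _).trans
        (mul_le_mul_of_nonneg_right ?_ (norm_nonneg _))
      exact (norm_pow_le' W hj).trans (pow_le_pow_left₀ (norm_nonneg _) (le_max_left _ _) j)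
  rw [h2] at hω
  have h4 := hω.trans_le h3
  rw [mul_comm] at h4
  exact lt_of_mul_lt_mul_left h4 (by positivity)

/-- Subtracting a suitable moving average turns an ARMA(1,q) equation into a first-order recursion
driven by a single noise vector. -/
lemma arma_state_recursion (Ψ : Matrix (Fin m) (Fin m) ℂ)
    (Θ : Fin (q + 1) → Matrix (Fin m) (Fin d) ℂ) (z : ℤ → Fin d → ℂ) (y : ℤ → Fin m → ℂ)
    (h : ∀ t : ℤ, y t - Ψ *ᵥ y (t - 1) = ∑ k : Fin (q + 1), Θ k *ᵥ z (t - ((k : ℕ) : ℤ))) (t : ℤ) :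
    (y t - ∑ k : Fin (q + 1), ∑ i ∈ Finset.range (q - (k : ℕ)),
        (Ψ ^ i * Θ k) *ᵥ z (t - ((k : ℕ) : ℤ) - i)) -
      Ψ *ᵥ (y (t - 1) - ∑ k : Fin (q + 1), ∑ i ∈ Finset.range (q - (k : ℕ)),
        (Ψ ^ i * Θ k) *ᵥ z (t - 1 - ((k : ℕ) : ℤ) - i)) =
      (∑ k : Fin (q + 1), Ψ ^ (q - (k : ℕ)) * Θ k) *ᵥ z (t - q) := by
  have h1 : Ψ *ᵥ (∑ k : Fin (q + 1), ∑ i ∈ Finset.range (q - (k : ℕ)),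
        (Ψ ^ i * Θ k) *ᵥ z (t - 1 - ((k : ℕ) : ℤ) - i)) =
      ∑ k : Fin (q + 1), ∑ i ∈ Finset.range (q - (k : ℕ)),
        (Ψ ^ (i + 1) * Θ k) *ᵥ z (t - ((k : ℕ) : ℤ) - ((i + 1 : ℕ) : ℤ)) := by
    simp only [← Matrix.mulVecLin_apply Ψ, map_sum]
    refine Finset.sum_congr rfl fun k _ => Finset.sum_congr rfl fun i _ => ?_
    rw [Matrix.mulVecLin_apply, Matrix.mulVec_mulVec, ← Matrix.mul_assoc, ← pow_succ']
    congr 2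
    push_cast
    ring
  -- Telescoping in `i` carries the noise at time `t - k` to the common time `t - q`, at the cost of
  -- a factor `Ψ ^ (q - k)`.
  have h2 : ∀ k : Fin (q + 1), (∑ i ∈ Finset.range (q - (k : ℕ)),
        (Ψ ^ i * Θ k) *ᵥ z (t - ((k : ℕ) : ℤ) - i)) -
      ∑ i ∈ Finset.range (q - (k : ℕ)),
        (Ψ ^ (i + 1) * Θ k) *ᵥ z (t - ((k : ℕ) : ℤ) - ((i + 1 : ℕ) : ℤ)) =
      Θ k *ᵥ z (t - ((k : ℕ) : ℤ)) - (Ψ ^ (q - (k : ℕ)) * Θ k) *ᵥ z (t - q) := by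
    intro k
    rw [← Finset.sum_sub_distrib, Finset.sum_range_sub' fun i : ℕ =>
      (Ψ ^ i * Θ k) *ᵥ z (t - ((k : ℕ) : ℤ) - i)]
    have hk : (k : ℕ) ≤ q := Nat.lt_succ_iff.1 k.2
    simp only [pow_zero, Matrix.one_mul, Nat.cast_zero, sub_zero]
    congr 3
    rw [Nat.cast_sub hk]
    ring
  have h3 := Finset.sum_congr (rfl : Finset.univ = Finset.univ) fun k _ => h2 k
  rw [Finset.sum_sub_distrib, Finset.sum_sub_distrib, ← h t] at h3
  rw [Matrix.mulVec_sub, h1, Matrix.sum_mulVec]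
  have e : ∀ a b c e f : Fin m → ℂ, c - e = a - b - f → a - c - (b - e) = f := by
    intro a b c e f h
    have : f = a - b - (c - e) := by rw [h]; abel
    rw [this]; abel
  exact e _ _ _ _ _ h3

lemma exists_norm_le_of_rank_eq (M : Matrix (Fin m) (Fin d) ℂ) (h : M.rank = d) :
    ∃ c : ℝ, 0 ≤ c ∧ ∀ x, ‖x‖ ≤ c * ‖M *ᵥ x‖ := by
  have hker : LinearMap.ker M.mulVecLin = ⊥ := by
    have h1 := M.mulVecLin.finrank_range_add_finrank_ker
    rw [← Matrix.rank, h, Module.finrank_fin_fun] at h1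
    exact Submodule.finrank_eq_zero.1 (by omega)
  obtain ⟨K, -, hK⟩ := M.mulVecLin.exists_antilipschitzWith hker
  refine ⟨K, K.2, fun x => ?_⟩
  simpa using hK.le_mul_dist x 0

/-- A strictly stationary solution forces a finite logarithmic moment of the noise. -/
theorem lintegral_posLog_lt_top_of_stationary [IsProbabilityMeasure P]
    {Z : ℤ → Ω → Fin d → ℂ} (hZ : IsIIDSequence P Z)
    (u : (Matrix (Fin m) (Fin m) ℂ)ˣ)
    (hu : ∀ μ ∈ (u : Matrix (Fin m) (Fin m) ℂ).charpoly.roots, ‖μ‖ ≠ 1)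
    (Θ : Fin (q + 1) → Matrix (Fin m) (Fin d) ℂ)
    (hrank : (∑ k : Fin (q + 1), (u : Matrix (Fin m) (Fin m) ℂ) ^ (q - (k : ℕ)) * Θ k).rank = d)
    {Y : ℤ → Ω → Fin m → ℂ} (hY : IsARMASolution P (u : Matrix (Fin m) (Fin m) ℂ) Θ Z Y)
    (hst : IsStrictlyStationary P Y) :
    ∫⁻ ω, ENNReal.ofReal (log⁺ ‖Z 0 ω‖) ∂P < ∞ := by
  obtain ⟨p₁, p₂, hc₁, hc₂, hp, r, K, hr0, hr1, hK₁, hK₂⟩ := Matrix.exists_dichotomy u hu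
  have hK0 : 0 ≤ K := by simpa using (norm_nonneg _).trans (hK₁ 0)
  have hKr : ∀ n : ℕ, K * r ^ n ≤ K := fun n =>
    mul_le_of_le_one_right hK0 (pow_le_one₀ hr0.le hr1.le)
  set U : Matrix (Fin m) (Fin m) ℂ := (u : Matrix (Fin m) (Fin m) ℂ)
  set W : Matrix (Fin m) (Fin m) ℂ := ((u⁻¹ : (Matrix (Fin m) (Fin m) ℂ)ˣ) : Matrix (Fin m) (Fin m) ℂ)
  set M := ∑ k : Fin (q + 1), U ^ (q - (k : ℕ)) * Θ k
  set V : ℤ → Ω → Fin m → ℂ := fun t ω => Y t ω -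
    ∑ k : Fin (q + 1), ∑ i ∈ Finset.range (q - (k : ℕ)),
      (U ^ i * Θ k) *ᵥ Z (t - ((k : ℕ) : ℤ) - i) ω
  -- Stationarity enters only here, through the common law of the `Y t`.
  have hVb : IsBoundedInProbability P V := by
    have hYb : IsBoundedInProbability P Y :=
      .of_identDistrib (hY.measurable 0) fun t => hst.identDistrib t
    have hZb : IsBoundedInProbability P Z := .of_identDistrib (hZ.measurable 0) hZ.identDistrib
    refine hYb.sub (.finset_sum _ fun k _ => .finset_sum _ fun i _ => ?_)
    exact (hZb.comp fun t : ℤ => t - ((k : ℕ) : ℤ) - i).mono_norm fun t =>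
      ae_of_all _ fun ω => Matrix.linfty_opNorm_mulVec _ _
  have hrec : ∀ᵐ ω ∂P, ∀ t : ℤ, V t ω - U *ᵥ V (t - 1) ω = M *ᵥ Z (t - q) ω := by
    filter_upwards [hY.equation] with ω hω t
    exact arma_state_recursion U Θ (fun t => Z t ω) (fun t => Y t ω) hω t
  clear_value V
  have hfwd : ∫⁻ ω, ENNReal.ofReal (log⁺ ‖p₁ *ᵥ (M *ᵥ Z 0 ω)‖) ∂P < ∞ := by
    refine lintegral_posLog_lt_top_of_recursion hZ (f := fun j => -(j : ℤ) - q) (fun a b h => ?_)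
      u hc₁ (fun n => (hK₁ n).trans (hKr n)) M (hVb.comp fun j : ℕ => -(j : ℤ)) ?_
    · simp only at h
      omega
    · filter_upwards [hrec] with ω hω j
      rw [← hω (-(j : ℤ))]
      congr 3
      push_cast
      ring
  -- Multiplication by `W = U⁻¹` reverses time: `V j - W V (j+1) = -(W M) Z (j+1-q)`, now
  -- contractive on the range of `p₂`.
  have hbwd : ∫⁻ ω, ENNReal.ofReal (log⁺ ‖p₂ *ᵥ ((-(W * M)) *ᵥ Z 0 ω)‖) ∂P < ∞ := by
    refine lintegral_posLog_lt_top_of_recursion hZ (f := fun j => (j : ℤ) + 1 - q) (fun a b h => ?_)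
      u⁻¹ (Commute.units_inv_left hc₂) (fun n => (hK₂ n).trans (hKr n)) (-(W * M))
      (hVb.comp fun j : ℕ => (j : ℤ)) ?_
    · simp only at h
      omega
    · filter_upwards [hrec] with ω hω j
      have h1 := hω ((j : ℤ) + 1)
      rw [add_sub_cancel_right] at h1
      rw [Matrix.neg_mulVec, ← Matrix.mulVec_mulVec, ← h1, Matrix.mulVec_sub W,
        Matrix.mulVec_mulVec _ W U, show W * U = 1 from Units.inv_mul u, Matrix.one_mulVec, neg_sub, Nat.cast_succ]
  obtain ⟨c, hc0, hc⟩ := exists_norm_le_of_rank_eq M hrank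
  set D := c * (1 + ‖U‖)
  have hD0 : 0 ≤ D := mul_nonneg hc0 (by positivity)
  have hbound : ∀ x : Fin d → ℂ, ‖x‖ ≤ D * (‖p₁ *ᵥ (M *ᵥ x)‖ + ‖p₂ *ᵥ ((-(W * M)) *ᵥ x)‖) := by
    intro x
    have h1 : M *ᵥ x = p₁ *ᵥ (M *ᵥ x) - U *ᵥ (p₂ *ᵥ ((-(W * M)) *ᵥ x)) := by
      rw [Matrix.neg_mulVec, Matrix.mulVec_neg, Matrix.mulVec_neg, sub_neg_eq_add,
        ← Matrix.mulVec_mulVec, Matrix.mulVec_mulVec _ U, hc₂.eq, ← Matrix.mulVec_mulVec _ p₂,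
        Matrix.mulVec_mulVec _ U, Units.mul_inv, Matrix.one_mulVec, ← Matrix.add_mulVec, hp,
        Matrix.one_mulVec]
    have h2 : ‖M *ᵥ x‖ ≤ ‖p₁ *ᵥ (M *ᵥ x)‖ + ‖U‖ * ‖p₂ *ᵥ ((-(W * M)) *ᵥ x)‖ := by
      conv_lhs => rw [h1]
      exact (norm_sub_le _ _).trans (add_le_add le_rfl (Matrix.linfty_opNorm_mulVec _ _))
    refine (hc x).trans ?_
    rw [mul_assoc]
    refine mul_le_mul_of_nonneg_left (h2.trans ?_) hc0
    nlinarith [mul_nonneg (norm_nonneg U) (norm_nonneg (p₁ *ᵥ (M *ᵥ x))),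
      norm_nonneg (p₂ *ᵥ ((-(W * M)) *ᵥ x))]
  have hlog : ∀ ω, ENNReal.ofReal (log⁺ ‖Z 0 ω‖) ≤ ENNReal.ofReal (log⁺ D + log 2) +
      (ENNReal.ofReal (log⁺ ‖p₁ *ᵥ (M *ᵥ Z 0 ω)‖) +
        ENNReal.ofReal (log⁺ ‖p₂ *ᵥ ((-(W * M)) *ᵥ Z 0 ω)‖)) := by
    intro ω
    rw [← ENNReal.ofReal_add posLog_nonneg posLog_nonneg, ← ENNReal.ofReal_add
      (add_nonneg posLog_nonneg (log_nonneg one_le_two)) (add_nonneg posLog_nonneg posLog_nonneg)]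
    refine ENNReal.ofReal_le_ofReal ((posLog_le_posLog (norm_nonneg _) (hbound _)).trans ?_)
    refine posLog_mul.trans ?_
    linarith [posLog_add (x := ‖p₁ *ᵥ (M *ᵥ Z 0 ω)‖) (y := ‖p₂ *ᵥ ((-(W * M)) *ᵥ Z 0 ω)‖)]
  refine (lintegral_mono hlog).trans_lt ?_
  rw [lintegral_add_left measurable_const, lintegral_add_left]
  · simp only [lintegral_const, measure_univ, mul_one]
    exact ENNReal.add_lt_top.2 ⟨ENNReal.ofReal_lt_top, ENNReal.add_lt_top.2 ⟨hfwd, hbwd⟩⟩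
  · exact (continuous_posLog.measurable.comp (((measurable_mulVec p₁).comp
      (measurable_mulVec M)).comp (hZ.measurable 0)).norm).ennreal_ofReal

end Necessity

/-! ### Construction of a stationary solution. -/

section Sufficiency

open Real
open scoped Matrix Matrix.Norms.Operator ENNReal

variable {Ω : Type*} [MeasurableSpace Ω] {P : Measure Ω} {m d q : ℕ}

/-- Independence makes the law of the whole path the product of its marginals, and these are all
equal. -/
lemma IsIIDSequence.identDistrib_shift {E : Type*} [MeasurableSpace E] [IsProbabilityMeasure P]
    {Z : ℤ → Ω → E} (hZ : IsIIDSequence P Z) (h : ℤ) :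
    IdentDistrib (fun ω s => Z (s + h) ω) (fun ω s => Z s ω) P P where
  aemeasurable_fst := (measurable_pi_lambda _ fun s => hZ.measurable (s + h)).aemeasurable
  aemeasurable_snd := (measurable_pi_lambda _ fun s => hZ.measurable s).aemeasurable
  map_eq := by
    have h1 : iIndepFun (fun s => Z (s + h)) P := hZ.indep.precomp (add_left_injective h)
    rw [h1.map_fun_eq_infinitePi_map fun s => hZ.measurable (s + h),
      hZ.indep.map_fun_eq_infinitePi_map hZ.measurable]
    congr 1
    ext1 s
    rw [(hZ.identDistrib (s + h)).map_eq, (hZ.identDistrib s).map_eq]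

/-- A measurable functional of the shifted i.i.d. sequence is strictly stationary. -/
lemma IsIIDSequence.isStrictlyStationary {E F : Type*} [MeasurableSpace E] [MeasurableSpace F]
    [IsProbabilityMeasure P] {Z : ℤ → Ω → E} (hZ : IsIIDSequence P Z) {f : (ℤ → E) → F}
    (hf : Measurable f) : IsStrictlyStationary P fun t ω => f fun s => Z (t + s) ω := by
  intro n s h
  have hg : Measurable fun (z : ℤ → E) (i : Fin n) => f fun r => z (s i + r) :=
    measurable_pi_lambda _ fun i =>
      hf.comp (measurable_pi_lambda _ fun r => measurable_pi_apply (s i + r))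
  have := (hZ.identDistrib_shift h).comp hg
  simpa only [Function.comp_def, add_right_comm] using this

lemma IsIIDSequence.ae_summable [IsProbabilityMeasure P] {Z : ℤ → Ω → Fin d → ℂ}
    (hZ : IsIIDSequence P Z) (hlog : ∫⁻ ω, ENNReal.ofReal (log⁺ ‖Z 0 ω‖) ∂P < ∞)
    {r : ℝ} (hr0 : 0 < r) (hr1 : r < 1) :
    ∀ᵐ ω ∂P, ∀ t : ℤ, Summable fun j : ℤ => r ^ j.natAbs * ‖Z (t - j) ω‖ := by
  rw [ae_all_iff]
  intro t
  have hid : ∀ s, IdentDistrib (fun ω => ‖Z s ω‖) (fun ω => ‖Z 0 ω‖) P P := fun s =>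
    (hZ.identDistrib s).comp measurable_norm
  have h1 := ae_summable_pow_mul_of_lintegral_posLog (X := fun k ω => ‖Z (t - k) ω‖)
    (hZ.measurable 0).norm (fun k ω => norm_nonneg _) (fun k => hid _) hlog hr0 hr1
  have h2 := ae_summable_pow_mul_of_lintegral_posLog (X := fun k ω => ‖Z (t + k) ω‖)
    (hZ.measurable 0).norm (fun k ω => norm_nonneg _) (fun k => hid _) hlog hr0 hr1
  filter_upwards [h1, h2] with ω h1 h2
  refine Summable.of_nat_of_neg ?_ ?_
  · simpa using h1
  · simpa using h2

/-- The bilateral kernel attached to a dichotomy: the forward part propagates along `U ^ n`, the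
backward part along `W ^ n`, where `W` is the inverse of `U`. -/
def dichotomyKernel {A : Type*} [Ring A] (U W p₁ p₂ : A) : ℤ → A
  | Int.ofNat n => U ^ n * p₁
  | Int.negSucc n => -(W ^ (n + 1) * p₂)

lemma dichotomyKernel_sub {A : Type*} [Ring A] {U W p₁ p₂ : A} (hUW : U * W = 1)
    (hp : p₁ + p₂ = 1) (j : ℤ) :
    dichotomyKernel U W p₁ p₂ j - U * dichotomyKernel U W p₁ p₂ (j - 1) = if j = 0 then 1 else 0 := by
  have hpow : ∀ n : ℕ, U * (W ^ (n + 1) * p₂) = W ^ n * p₂ := fun n => by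
    rw [pow_succ', ← mul_assoc, ← mul_assoc, hUW, one_mul]
  rcases j with (_ | n) | n
  · change U ^ 0 * p₁ - U * -(W ^ (0 + 1) * p₂) = _
    rw [mul_neg, hpow, sub_neg_eq_add, pow_zero, pow_zero, one_mul, one_mul, hp]
    simp
  · have : (Int.ofNat (n + 1) : ℤ) - 1 = Int.ofNat n := by simp
    rw [this, if_neg (by simp; omega)]
    change U ^ (n + 1) * p₁ - U * (U ^ n * p₁) = 0
    rw [pow_succ', mul_assoc, sub_self]
  · have : Int.negSucc n - 1 = Int.negSucc (n + 1) := rfl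
    rw [this, if_neg (by simp)]
    change -(W ^ (n + 1) * p₂) - U * -(W ^ (n + 1 + 1) * p₂) = 0
    rw [mul_neg, hpow, sub_self]

lemma norm_dichotomyKernel_le {A : Type*} [NormedRing A] {U W p₁ p₂ : A} {r K : ℝ}
    (h₁ : ∀ k : ℕ, ‖U ^ k * p₁‖ ≤ K * r ^ k) (h₂ : ∀ k : ℕ, ‖W ^ k * p₂‖ ≤ K * r ^ k) (j : ℤ) :
    ‖dichotomyKernel U W p₁ p₂ j‖ ≤ K * r ^ j.natAbs := by
  rcases j with n | n
  · exact h₁ n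
  · change ‖-(W ^ (n + 1) * p₂)‖ ≤ _
    rw [norm_neg]
    exact h₂ (n + 1)

/-- Convolution with a summable resolvent kernel solves the first-order recursion. -/
lemma tsum_kernel_sub {U : Matrix (Fin m) (Fin m) ℂ} {G : ℤ → Matrix (Fin m) (Fin m) ℂ}
    (hG : ∀ j, G j - U * G (j - 1) = if j = 0 then 1 else 0) {w : ℤ → Fin m → ℂ}
    (hs : ∀ t, Summable fun j => G j *ᵥ w (t - j)) (t : ℤ) :
    (∑' j, G j *ᵥ w (t - j)) - U *ᵥ (∑' j, G j *ᵥ w (t - 1 - j)) = w t := by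
  have h1 : U *ᵥ (∑' j, G j *ᵥ w (t - 1 - j)) = ∑' j, (U * G (j - 1)) *ᵥ w (t - j) := by
    have := (LinearMap.toContinuousLinearMap U.mulVecLin).map_tsum (hs (t - 1))
    simp only [LinearMap.coe_toContinuousLinearMap', Matrix.mulVecLin_apply,
      Matrix.mulVec_mulVec] at this
    rw [this, ← (Equiv.subRight (1 : ℤ)).tsum_eq]
    refine tsum_congr fun j => ?_
    simp only [Equiv.subRight_apply]
    congr 2
    ring
  have h2 : Summable fun j => (U * G (j - 1)) *ᵥ w (t - j) := by
    have h3 := (hs (t - 1)).map (LinearMap.toContinuousLinearMap U.mulVecLin)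
      (ContinuousLinearMap.continuous _)
    have h4 := (Equiv.subRight (1 : ℤ)).summable_iff.2 h3
    refine h4.congr fun j => ?_
    simp only [Function.comp_apply, LinearMap.coe_toContinuousLinearMap', Matrix.mulVecLin_apply,
      Matrix.mulVec_mulVec, Equiv.subRight_apply]
    congr 2
    ring
  rw [h1, ← (hs t).tsum_sub h2]
  have h5 : ∀ j, G j *ᵥ w (t - j) - (U * G (j - 1)) *ᵥ w (t - j) = if j = 0 then w t else 0 := by
    intro j
    rw [← Matrix.sub_mulVec, hG]
    split_ifs with hj
    · rw [hj, sub_zero, Matrix.one_mulVec]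
    · rw [Matrix.zero_mulVec]
  rw [tsum_congr h5, tsum_ite_eq]

/-- A finite logarithmic moment of the noise yields a strictly stationary solution. -/
theorem exists_stationary_solution [IsProbabilityMeasure P] {Z : ℤ → Ω → Fin d → ℂ}
    (hZ : IsIIDSequence P Z) (u : (Matrix (Fin m) (Fin m) ℂ)ˣ)
    (hu : ∀ μ ∈ (u : Matrix (Fin m) (Fin m) ℂ).charpoly.roots, ‖μ‖ ≠ 1)
    (Θ : Fin (q + 1) → Matrix (Fin m) (Fin d) ℂ)
    (hlog : ∫⁻ ω, ENNReal.ofReal (log⁺ ‖Z 0 ω‖) ∂P < ∞) :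
    ∃ Y : ℤ → Ω → Fin m → ℂ, IsARMASolution P (u : Matrix (Fin m) (Fin m) ℂ) Θ Z Y ∧
      IsStrictlyStationary P Y := by
  obtain ⟨p₁, p₂, -, -, hp, r, K, hr0, hr1, hK₁, hK₂⟩ := Matrix.exists_dichotomy u hu
  set U : Matrix (Fin m) (Fin m) ℂ := (u : Matrix (Fin m) (Fin m) ℂ)
  set W : Matrix (Fin m) (Fin m) ℂ :=
    ((u⁻¹ : (Matrix (Fin m) (Fin m) ℂ)ˣ) : Matrix (Fin m) (Fin m) ℂ)
  set G := dichotomyKernel U W p₁ p₂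
  have hG := dichotomyKernel_sub (U := U) (W := W) (Units.mul_inv u) hp
  have hGn := norm_dichotomyKernel_le hK₁ hK₂
  change ∀ j, G j - U * G (j - 1) = _ at hG
  change ∀ j, ‖G j‖ ≤ _ at hGn
  clear_value G
  -- Where the series is not summable, `tsum` is 0, so `f` is measurable on all paths and
  -- stationarity holds without exceptional sets; summability matters only for the equation.
  obtain ⟨f, hfe, hf⟩ : ∃ f : (ℤ → Fin d → ℂ) → Fin m → ℂ,
      (∀ z, f z = ∑' j : ℤ, G j *ᵥ ∑ k : Fin (q + 1), Θ k *ᵥ z (-j - ((k : ℕ) : ℤ))) ∧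
        Measurable f :=
    ⟨_, fun _ => rfl, Measurable.tsum fun j => (measurable_mulVec (G j)).comp
      (Finset.measurable_fun_sum _ fun k _ =>
        (measurable_mulVec (Θ k)).comp (measurable_pi_apply _))⟩
  refine ⟨fun t ω => f fun s => Z (t + s) ω, ⟨fun t => ?_, ?_⟩, hZ.isStrictlyStationary hf⟩
  · exact hf.comp (measurable_pi_lambda _ fun s => hZ.measurable (t + s))
  · filter_upwards [hZ.ae_summable hlog hr0 hr1] with ω hω t
    set w : ℤ → Fin m → ℂ := fun t => ∑ k : Fin (q + 1), Θ k *ᵥ Z (t - ((k : ℕ) : ℤ)) ω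
    have hfw : ∀ t, (f fun s => Z (t + s) ω) = ∑' j, G j *ᵥ w (t - j) := by
      intro t
      rw [hfe]
      refine tsum_congr fun j => ?_
      simp only [w]
      congr 2
      ext1 k
      rw [show t + (-j - ((k : ℕ) : ℤ)) = t - j - ((k : ℕ) : ℤ) by ring]
    rw [hfw, hfw]
    refine tsum_kernel_sub hG (fun t => ?_) t
    have hs : Summable fun j : ℤ => ∑ k : Fin (q + 1),
        (K * ‖Θ k‖) * (r ^ j.natAbs * ‖Z (t - ((k : ℕ) : ℤ) - j) ω‖) :=
      summable_sum fun k _ => (hω (t - ((k : ℕ) : ℤ))).mul_left _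
    refine Summable.of_norm_bounded hs fun j => ?_
    have hKr : 0 ≤ K * r ^ j.natAbs := (norm_nonneg _).trans (hGn j)
    calc ‖G j *ᵥ w (t - j)‖ ≤ ‖G j‖ * ‖w (t - j)‖ := Matrix.linfty_opNorm_mulVec _ _
      _ ≤ (K * r ^ j.natAbs) * ∑ k : Fin (q + 1), ‖Θ k‖ * ‖Z (t - j - ((k : ℕ) : ℤ)) ω‖ := by
          refine mul_le_mul (hGn j) ?_ (norm_nonneg _) hKr
          exact (norm_sum_le _ _).trans
            (Finset.sum_le_sum fun k _ => Matrix.linfty_opNorm_mulVec _ _)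
      _ = _ := by
          rw [Finset.mul_sum]
          refine Finset.sum_congr rfl fun k _ => ?_
          rw [sub_right_comm]
          ring

end Sufficiency

/-! ### Independence of the choice of norm, and the equivalence. -/

section LogMomentComparison

open Real
open scoped ENNReal

/-- A multiplicative constant costs only the additive constant `log⁺ c`, integrable over a finite
measure. -/
lemma lintegral_posLog_lt_top_of_le_mul {Ω : Type*} [MeasurableSpace Ω] {P : Measure Ω}
    [IsFiniteMeasure P] {f g : Ω → ℝ} {c : ℝ} (hf : ∀ ω, 0 ≤ f ω) (h : ∀ ω, f ω ≤ c * g ω)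
    (hg : ∫⁻ ω, ENNReal.ofReal (log⁺ (g ω)) ∂P < ∞) :
    ∫⁻ ω, ENNReal.ofReal (log⁺ (f ω)) ∂P < ∞ := by
  have hpt : ∀ ω, ENNReal.ofReal (log⁺ (f ω)) ≤
      ENNReal.ofReal (log⁺ c) + ENNReal.ofReal (log⁺ (g ω)) := fun ω => by
    rw [← ENNReal.ofReal_add posLog_nonneg posLog_nonneg]
    exact ENNReal.ofReal_le_ofReal ((posLog_le_posLog (hf ω) (h ω)).trans posLog_mul)
  refine (lintegral_mono hpt).trans_lt ?_
  rw [lintegral_add_left measurable_const, lintegral_const]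
  exact ENNReal.add_lt_top.2
    ⟨ENNReal.mul_lt_top ENNReal.ofReal_lt_top (measure_lt_top P _), hg⟩

end LogMomentComparison

theorem corollary2 {Ω : Type*} [MeasurableSpace Ω] (P : Measure Ω) [IsProbabilityMeasure P]
    (m d q : ℕ) (hm : 1 ≤ m) (hd : 1 ≤ d)
    (norm_d : Seminorm ℂ (Fin d → ℂ)) (hnorm : ∀ x, norm_d x = 0 → x = 0)
    (Z : ℤ → Ω → Fin d → ℂ) (hZ : IsIIDSequence P Z)
    (Ψ : Matrix (Fin m) (Fin m) ℂ) (Θ : Fin (q + 1) → Matrix (Fin m) (Fin d) ℂ)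
    (hΨ : ∀ μ : ℂ, Module.End.HasEigenvalue (Matrix.toLin' Ψ) μ →
      ‖μ‖ ∈ Set.Ioo (0 : ℝ) 1 ∪ Set.Ioi (1 : ℝ))
    (hdm : d ≤ m)
    (hrank : (∑ k : Fin (q + 1), Ψ ^ (q - (k : ℕ)) * Θ k).rank = d) :
    (∃ Y : ℤ → Ω → Fin m → ℂ, IsARMASolution P Ψ Θ Z Y ∧ IsStrictlyStationary P Y) ↔
      ∫⁻ ω, ENNReal.ofReal (Real.log (max 1 (norm_d (Z 0 ω)))) ∂P < ⊤ := by
  obtain ⟨u, rfl, hu⟩ := Ψ.exists_unit_of_hyperbolic hΨ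
  obtain ⟨c, -, hc⟩ := norm_d.exists_le_mul_norm
  obtain ⟨c', -, hc'⟩ := norm_d.exists_norm_le_mul hnorm
  simp only [← Real.posLog_eq_log_max_one (apply_nonneg norm_d _)]
  constructor
  · rintro ⟨Y, hY, hst⟩
    exact lintegral_posLog_lt_top_of_le_mul (fun ω => apply_nonneg norm_d _) (fun ω => hc _)
      (lintegral_posLog_lt_top_of_stationary hZ u hu Θ hrank hY hst)
  · intro h
    exact exists_stationary_solution hZ u hu Θ
      (lintegral_posLog_lt_top_of_le_mul (fun ω => norm_nonneg _) (fun ω => hc' _) h)
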